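/- A double-Heyting algebra is an algebra $\mathbf A=\langle A,\wedge,\vee,\to,-,0,1\rangle$ such that $\langle A,\wedge,\vee,0,1\rangle$ is a bounded lattice, $a\wedge b\le c\iff a\le b\to c$, and $a-b\le c\iff a\le b\vee c$. A variety $\mathcal V$ of double-Heyting algebras is the class of all double-Heyting algebras satisfying some set of equations. The canonical extension of $\mathbf A$ is the algebra $\mathbf A^\sigma=\langle C,\wedge,\vee,\to^\pi,-^\sigma,0,1\rangle$, where $C$ is the (unique up to isomorphism) complete lattice containing $A$ as a bounded sublattice such that, with $K$ and $O$ the sets of all meets and of all joins in $C$ of subsets of $A$: every element of $C$ is both a join of elements of $K$ and a meet of elements of $O$; and for $S\subseteq K$, $T\subseteq O$, $\bigwedge S\le\bigvee T$ if and only if $\bigwedge S_0\le\bigvee T_0$ for some finite $S_0\subseteq S$, $T_0\subseteq T$. For $x,y\in C$, $$x\to^\pi y=\bigwedge_{(k,o,k',o')}\ \bigvee\{a\to b : a,b\in A,\ k\le a\le o,\ k'\le b\le o'\},\qquad x-^\sigma y=\bigvee_{(k,o,k',o')}\ \bigwedge\{a-b : a,b\in A,\ k\le a\le o,\ k'\le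 b\le o'\},$$ with $k,k'\in K$ and $o,o'\in O$ ranging over all elements such that $k\le x\le o$ and $k'\le y\le o'$. The variety $\mathcal V$ is closed under canonical extensions if $\mathbf A^\sigma\in\mathcal V$ for all $\mathbf A\in\mathcal V$. A member of $\mathcal V$ is finitely presented if it is presented, relative to $\mathcal V$, by finitely many generators and finitely many relations; $\mathcal V$ is coherent if every finitely generated subalgebra of a finitely presented member of $\mathcal V$ is finitely presented. Finally, $\mathcal V$ is a discriminator variety if there is a ternary term $t$ such that, for every subdirectly irreducible $\mathbf A\in\mathcal V$ and all $a,b,c\in A$, $t^{\mathbf A}(a,b,c)=c$ if $a=b$, and $t^{\mathbf A}(a,b,c)=a$ if $a\ne b$. **Theorem 5.6.** Let $\mathcal V$ be a variety of double-Heyting algebras that is closed under canonical extensions. If $\mathcal V$ is coherent, then $\mathcal V$ is a discriminator variety. -/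

import Mathlib

universe u

namespace DoubleHeyting

/-- Terms, over the variables `X`, in the signature `∧, ∨, →, -, 0, 1` of double-Heyting algebras.
Double-Heyting algebras themselves are the `BiheytingAlgebra`s of Mathlib: `→` is `⇨`, and `-` is
`\`, with `a \ b ≤ c ↔ a ≤ b ⊔ c`. (The operations `ᶜ` and `￢` of Mathlib are determined by
`aᶜ = a ⇨ ⊥` and `￢a = ⊤ \ a`.) -/
inductive Term (X : Type) : Type
  | var (x : X) : Term X
  | inf (s t : Term X) : Term X
  | sup (s t : Term X) : Term X
  | imp (s t : Term X) : Term X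
  | sub (s t : Term X) : Term X
  | bot : Term X
  | top : Term X

/-- The value of a term in a double-Heyting algebra under an assignment of the variables. -/
def Term.eval {X : Type} {A : Type u} [BiheytingAlgebra A] (a : X → A) : Term X → A
  | .var x => a x
  | .inf s t => s.eval a ⊓ t.eval a
  | .sup s t => s.eval a ⊔ t.eval a
  | .imp s t => s.eval a ⇨ t.eval a
  | .sub s t => s.eval a \ t.eval a
  | .bot => ⊥
  | .top => ⊤

/-- An equation `s ≈ t` between terms over `X`. -/
abbrev Equation (X : Type) : Type := Term X × Term X

/-- The equation holds under the given assignment. -/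
def Equation.Holds {X : Type} {A : Type u} [BiheytingAlgebra A] (a : X → A)
    (ε : Equation X) : Prop :=
  ε.1.eval a = ε.2.eval a

/-- A variety of double-Heyting algebras is the class of all double-Heyting algebras that satisfy a
given set of equations; it is represented by such a set. -/
structure Variety : Type where
  identities : Set (Equation ℕ)

/-- Membership of a double-Heyting algebra in a variety. -/
def Variety.Mem (V : Variety) (A : Type u) [BiheytingAlgebra A] : Prop :=
  ∀ ε ∈ V.identities, ∀ a : ℕ → A, ε.Holds a

/-! ### Subalgebras, presentations and coherence -/

/-- Subalgebras of a double-Heyting algebra. -/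
structure Subalgebra (A : Type u) [BiheytingAlgebra A] where
  carrier : Set A
  inf_mem : ∀ {x y : A}, x ∈ carrier → y ∈ carrier → x ⊓ y ∈ carrier
  sup_mem : ∀ {x y : A}, x ∈ carrier → y ∈ carrier → x ⊔ y ∈ carrier
  himp_mem : ∀ {x y : A}, x ∈ carrier → y ∈ carrier → x ⇨ y ∈ carrier
  sdiff_mem : ∀ {x y : A}, x ∈ carrier → y ∈ carrier → x \ y ∈ carrier
  bot_mem : ⊥ ∈ carrier
  top_mem : ⊤ ∈ carrier

/-- The elements of a subalgebra, as a type. -/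
abbrev Subalgebra.Elem {A : Type u} [BiheytingAlgebra A] (S : Subalgebra A) : Type u :=
  {x : A // x ∈ S.carrier}

/-- A subalgebra is a double-Heyting algebra under the restricted operations. -/
instance Subalgebra.instBiheytingAlgebra {A : Type u} [BiheytingAlgebra A] (S : Subalgebra A) :
    BiheytingAlgebra S.Elem :=
  letI : Max S.Elem := ⟨fun x y => ⟨x.1 ⊔ y.1, S.sup_mem x.2 y.2⟩⟩
  letI : Min S.Elem := ⟨fun x y => ⟨x.1 ⊓ y.1, S.inf_mem x.2 y.2⟩⟩
  letI : Top S.Elem := ⟨⟨⊤, S.top_mem⟩⟩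
  letI : Bot S.Elem := ⟨⟨⊥, S.bot_mem⟩⟩
  letI : Compl S.Elem := ⟨fun x => ⟨x.1ᶜ, himp_bot x.1 ▸ S.himp_mem x.2 S.bot_mem⟩⟩
  letI : HNot S.Elem := ⟨fun x => ⟨￢x.1, top_sdiff' x.1 ▸ S.sdiff_mem S.top_mem x.2⟩⟩
  letI : HImp S.Elem := ⟨fun x y => ⟨x.1 ⇨ y.1, S.himp_mem x.2 y.2⟩⟩
  letI : SDiff S.Elem := ⟨fun x y => ⟨x.1 \ y.1, S.sdiff_mem x.2 y.2⟩⟩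
  Subtype.val_injective.biheytingAlgebra Subtype.val
    Iff.rfl Iff.rfl (fun _ _ => rfl) (fun _ _ => rfl) rfl rfl
    (fun _ => rfl) (fun _ => rfl) (fun _ _ => rfl) (fun _ _ => rfl)

/-- `S` is the subalgebra generated by the set `G`. -/
def Subalgebra.IsGeneratedBy {A : Type u} [BiheytingAlgebra A] (S : Subalgebra A)
    (G : Set A) : Prop :=
  G ⊆ S.carrier ∧ ∀ T : Subalgebra A, G ⊆ T.carrier → S.carrier ⊆ T.carrier

/-- `S` is a finitely generated subalgebra. -/
def Subalgebra.FinitelyGenerated {A : Type u} [BiheytingAlgebra A] (S : Subalgebra A) : Prop :=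
  ∃ G : Set A, G.Finite ∧ S.IsGeneratedBy G

/-- The algebra `A` in `V` is presented, relative to `V`, by the generators `a 0, …, a (n - 1)` and
the relations `R`: it is generated by them, they satisfy the relations, and whenever elements
`b 0, …, b (n - 1)` of a member of `V` satisfy the relations, there is a (necessarily unique)
homomorphism that takes each `a i` to `b i`. Equivalently, `A` is the quotient of the free algebra
of `V` over `n` generators by the congruence generated by `R`. -/
structure IsPresentedBy (V : Variety) (A : Type u) [BiheytingAlgebra A] {n : ℕ} (a : Fin n → A)
    (R : Set (Equation (Fin n))) : Prop where
  mem : V.Mem A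
  generates : ∀ T : Subalgebra A, Set.range a ⊆ T.carrier → T.carrier = Set.univ
  relations : ∀ ε ∈ R, ε.Holds a
  lift : ∀ (B : Type u) [BiheytingAlgebra B], V.Mem B → ∀ b : Fin n → B,
    (∀ ε ∈ R, ε.Holds b) → ∃ f : BiheytingHom A B, ∀ i, f (a i) = b i

/-- `A` is a finitely presented member of `V`. -/
def FinitelyPresented (V : Variety) (A : Type u) [BiheytingAlgebra A] : Prop :=
  ∃ (n : ℕ) (a : Fin n → A) (R : Set (Equation (Fin n))), R.Finite ∧ IsPresentedBy V A a R

/-- `V` is coherent: every finitely generated subalgebra of a finitely presented member of `V` is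
finitely presented. -/
def Variety.Coherent (V : Variety) : Prop :=
  ∀ (B : Type u) [BiheytingAlgebra B], FinitelyPresented V B →
    ∀ S : Subalgebra B, S.FinitelyGenerated → FinitelyPresented V S.Elem

/-! ### Canonical extensions -/

section Canonical

variable {A C : Type u} [BiheytingAlgebra A] [CompleteLattice C]

/-- Closed elements of a completion: meets of elements of `A`. -/
def IsClosedElem (e : BoundedLatticeHom A C) (k : C) : Prop := ∃ X : Set A, k = sInf (e '' X)

/-- Open elements of a completion: joins of elements of `A`. -/
def IsOpenElem (e : BoundedLatticeHom A C) (o : C) : Prop := ∃ X : Set A, o = sSup (e '' X)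

/-- `e : A → C` is a canonical extension of the bounded lattice `A`, that is, a dense and compact
completion. An injective homomorphism of bounded lattices is an order embedding that preserves all
finite meets and joins. -/
structure IsCanonicalExtension (e : BoundedLatticeHom A C) : Prop where
  injective : Function.Injective e
  dense_closed : ∀ x : C, ∃ S : Set C, (∀ k ∈ S, IsClosedElem e k) ∧ x = sSup S
  dense_open : ∀ x : C, ∃ S : Set C, (∀ o ∈ S, IsOpenElem e o) ∧ x = sInf S
  compact : ∀ S T : Set C, (∀ k ∈ S, IsClosedElem e k) → (∀ o ∈ T, IsOpenElem e o) →
    (sInf S ≤ sSup T ↔ ∃ S₀ ⊆ S, ∃ T₀ ⊆ T, S₀.Finite ∧ T₀.Finite ∧ sInf S₀ ≤ sSup T₀)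

/-- A box around `(x, y)`: closed elements below and open elements above the two coordinates.
The bounds are `k₁ ≤ x ≤ o₁` and `k₂ ≤ y ≤ o₂`. -/
structure IsBox (e : BoundedLatticeHom A C) (x y k₁ o₁ k₂ o₂ : C) : Prop where
  closed₁ : IsClosedElem e k₁
  open₁ : IsOpenElem e o₁
  closed₂ : IsClosedElem e k₂
  open₂ : IsOpenElem e o₂
  le₁ : k₁ ≤ x
  ge₁ : x ≤ o₁
  le₂ : k₂ ≤ y
  ge₂ : y ≤ o₂

/-- The values of `f` on the pairs of elements of `A` that lie in a box. -/
def boxValues (e : BoundedLatticeHom A C) (f : A → A → A) (k₁ o₁ k₂ o₂ : C) : Set C :=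
  {c | ∃ a b : A, k₁ ≤ e a ∧ e a ≤ o₁ ∧ k₂ ≤ e b ∧ e b ≤ o₂ ∧ c = e (f a b)}

/-- The extension `f^σ` of a binary operation `f`, the join over all boxes around `(x, y)` of the
meet of the values of `f` in the box. Passing to the order dual in one argument of `f` exchanges
closed and open elements there, and hence gives the same boxes and the same extension. -/
def sigmaExt (e : BoundedLatticeHom A C) (f : A → A → A) (x y : C) : C :=
  sSup {c | ∃ k₁ o₁ k₂ o₂ : C, IsBox e x y k₁ o₁ k₂ o₂ ∧ c = sInf (boxValues e f k₁ o₁ k₂ o₂)}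

/-- The extension `f^π` of a binary operation `f`, the meet over all boxes around `(x, y)` of the
join of the values of `f` in the box. -/
def piExt (e : BoundedLatticeHom A C) (f : A → A → A) (x y : C) : C :=
  sInf {c | ∃ k₁ o₁ k₂ o₂ : C, IsBox e x y k₁ o₁ k₂ o₂ ∧ c = sSup (boxValues e f k₁ o₁ k₂ o₂)}

/-- The double-Heyting algebra `inst` on `C` is the algebra `A^σ`: its order, and so `∧, ∨, 0, 1`,
are those of the complete lattice `C`, its implication is `→^π` and its subtraction is `-^σ`. -/
structure IsCanonicalAlgebra (e : BoundedLatticeHom A C) (inst : BiheytingAlgebra C) : Prop where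
  le_iff : ∀ x y : C, inst.le x y ↔ x ≤ y
  himp_eq : ∀ x y : C, inst.himp x y = piExt e (fun a b => a ⇨ b) x y
  sdiff_eq : ∀ x y : C, inst.sdiff x y = sigmaExt e (fun a b => a \ b) x y

end Canonical

/-- `V` is closed under canonical extensions: if `A` is in `V` then so is `A^σ`, for each
realisation `e : A → C` of the canonical extension of the lattice `A`. -/
def Variety.ClosedUnderCanonicalExtensions (V : Variety) : Prop :=
  ∀ (A : Type u) [BiheytingAlgebra A], V.Mem A →
    ∀ (C : Type u) [CompleteLattice C] (e : BoundedLatticeHom A C), IsCanonicalExtension e →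
      ∃ inst : BiheytingAlgebra C, IsCanonicalAlgebra e inst ∧ @Variety.Mem V C inst

/-! ### Discriminator varieties -/

/-- Congruences of a double-Heyting algebra. -/
structure Congruence (A : Type u) [BiheytingAlgebra A] extends Setoid A where
  inf : ∀ {x x' y y' : A}, toSetoid x x' → toSetoid y y' → toSetoid (x ⊓ y) (x' ⊓ y')
  sup : ∀ {x x' y y' : A}, toSetoid x x' → toSetoid y y' → toSetoid (x ⊔ y) (x' ⊔ y')
  himp : ∀ {x x' y y' : A}, toSetoid x x' → toSetoid y y' → toSetoid (x ⇨ y) (x' ⇨ y')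
  sdiff : ∀ {x x' y y' : A}, toSetoid x x' → toSetoid y y' → toSetoid (x \ y) (x' \ y')

/-- `A` is subdirectly irreducible: among its congruences different from equality there is a least
one. -/
def SubdirectlyIrreducible (A : Type u) [BiheytingAlgebra A] : Prop :=
  ∃ μ : Congruence A, μ.toSetoid ≠ ⊥ ∧
    ∀ θ : Congruence A, θ.toSetoid ≠ ⊥ → μ.toSetoid ≤ θ.toSetoid

/-- The ternary term `t` is a discriminator term for `A`: its value at `(a, b, c)` is `c` if
`a = b`, and `a` otherwise. -/
def IsDiscriminatorTerm (t : Term (Fin 3)) (A : Type u) [BiheytingAlgebra A] : Prop :=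
  ∀ a b c : A, (a = b → t.eval ![a, b, c] = c) ∧ (a ≠ b → t.eval ![a, b, c] = a)

/-- `V` is a discriminator variety: there is a ternary term which is a discriminator term for each
subdirectly irreducible member of `V`. -/
def Variety.IsDiscriminatorVariety (V : Variety) : Prop :=
  ∃ t : Term (Fin 3), ∀ (A : Type u) [BiheytingAlgebra A], V.Mem A → SubdirectlyIrreducible A →
    IsDiscriminatorTerm t A

end DoubleHeyting

namespace DoubleHeyting

open Filter

/-! Write □x = ¬∼x. It is monotone and deflationary, and its fixed points are complemented. In a
subdirectly irreducible algebra only 0 and 1 are complemented, so once □ⁿ⁺¹ = □ⁿ holds throughout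
the variety, □ⁿ((a → b) ∧ (b → a)) is 1 if a = b and 0 otherwise, which yields a discriminator term.
The work lies in finding n.

Let D be presented by z ≤ y ≤ x and □y = y. By coherence the subalgebra S generated by x and z is
finitely presented, and z ≤ □ᵏx in S for every k. Given a in a member A of the variety, take the
power of A modulo the filter `atTop` on ℕ, with x the constant sequence a and z the sequence of all
□ⁿa; again z ≤ □ᵏx for every k. The canonical extension of this reduced power is complete, and there
the meet of all □ᵏx is a fixed point, because □ is a right adjoint; it can serve as y. So D maps
into this extension, and each equation in x, z that is true in D holds at (a, □ⁿa) for all large n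
(`eventually_holds_of_holds`).

As S has a finite presentation, one n satisfies all the equations needed for a homomorphism S → A
with x ↦ a and z ↦ □ⁿa. It carries z ≤ □ⁿ⁺¹x to □ⁿa ≤ □ⁿ⁺¹a. A product of counterexamples makes n
uniform. -/

/-! ### Terms and homomorphisms -/

/-- Substitution of terms for the variables of a term. -/
def Term.subst {X Y : Type} (p : X → Term Y) : Term X → Term Y
  | .var x => p x
  | .inf s t => .inf (s.subst p) (t.subst p)
  | .sup s t => .sup (s.subst p) (t.subst p)
  | .imp s t => .imp (s.subst p) (t.subst p)
  | .sub s t => .sub (s.subst p) (t.subst p)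
  | .bot => .bot
  | .top => .top

theorem Term.eval_subst {X Y : Type} {A : Type u} [BiheytingAlgebra A] (p : X → Term Y)
    (a : Y → A) (s : Term X) : (s.subst p).eval a = s.eval fun x => (p x).eval a := by
  induction s <;> simp_all [Term.subst, Term.eval]

theorem Term.map_eval {X : Type} {A B : Type u} [BiheytingAlgebra A] [BiheytingAlgebra B]
    (f : BiheytingHom A B) (a : X → A) (s : Term X) :
    f (s.eval a) = s.eval fun x => f (a x) := by
  induction s <;> simp_all [Term.eval]

theorem Equation.Holds.map {X : Type} {A B : Type u} [BiheytingAlgebra A] [BiheytingAlgebra B]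
    (f : BiheytingHom A B) {a : X → A} {ε : Equation X} (h : ε.Holds a) :
    ε.Holds fun x => f (a x) := by
  unfold Equation.Holds at *
  rw [← Term.map_eval, ← Term.map_eval, h]

theorem Equation.Holds.of_map {X : Type} {A B : Type u} [BiheytingAlgebra A] [BiheytingAlgebra B]
    (f : BiheytingHom A B) (hf : Function.Injective f) {a : X → A} {ε : Equation X}
    (h : ε.Holds fun x => f (a x)) : ε.Holds a := by
  unfold Equation.Holds at *
  rw [← Term.map_eval, ← Term.map_eval] at h
  exact hf h

/-- Substitution of terms for the variables of an equation. -/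
def Equation.subst {X Y : Type} (p : X → Term Y) (ε : Equation X) : Equation Y :=
  (ε.1.subst p, ε.2.subst p)

theorem Equation.holds_subst {X Y : Type} {A : Type u} [BiheytingAlgebra A] {p : X → Term Y}
    {a : Y → A} {ε : Equation X} :
    (ε.subst p).Holds a ↔ ε.Holds fun x => (p x).eval a := by
  simp only [Equation.Holds, Equation.subst, Term.eval_subst]

/-- The inclusion of a subalgebra. -/
def Subalgebra.inclusion {A : Type u} [BiheytingAlgebra A] (S : Subalgebra A) :
    BiheytingHom S.Elem A where
  toFun := Subtype.val
  map_sup' _ _ := rfl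
  map_inf' _ _ := rfl
  map_himp' _ _ := rfl
  map_sdiff' _ _ := rfl

/-- The subalgebra of all values of terms under an assignment. -/
def Subalgebra.termValues {X : Type} {A : Type u} [BiheytingAlgebra A] (a : X → A) :
    Subalgebra A where
  carrier := Set.range fun s : Term X => s.eval a
  inf_mem := by rintro _ _ ⟨s, rfl⟩ ⟨t, rfl⟩; exact ⟨.inf s t, rfl⟩
  sup_mem := by rintro _ _ ⟨s, rfl⟩ ⟨t, rfl⟩; exact ⟨.sup s t, rfl⟩
  himp_mem := by rintro _ _ ⟨s, rfl⟩ ⟨t, rfl⟩; exact ⟨.imp s t, rfl⟩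
  sdiff_mem := by rintro _ _ ⟨s, rfl⟩ ⟨t, rfl⟩; exact ⟨.sub s t, rfl⟩
  bot_mem := ⟨.bot, rfl⟩
  top_mem := ⟨.top, rfl⟩

theorem Subalgebra.eval_mem {X : Type} {A : Type u} [BiheytingAlgebra A] (S : Subalgebra A)
    {a : X → A} (ha : Set.range a ⊆ S.carrier) (s : Term X) : s.eval a ∈ S.carrier := by
  induction s with
  | var x => exact ha ⟨x, rfl⟩
  | inf _ _ h₁ h₂ => exact S.inf_mem h₁ h₂
  | sup _ _ h₁ h₂ => exact S.sup_mem h₁ h₂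
  | imp _ _ h₁ h₂ => exact S.himp_mem h₁ h₂
  | sub _ _ h₁ h₂ => exact S.sdiff_mem h₁ h₂
  | bot => exact S.bot_mem
  | top => exact S.top_mem

theorem Subalgebra.range_subset_termValues {X : Type} {A : Type u} [BiheytingAlgebra A]
    (a : X → A) : Set.range a ⊆ (termValues a).carrier := by
  rintro _ ⟨x, rfl⟩
  exact ⟨.var x, rfl⟩

theorem Subalgebra.finitelyGenerated_termValues {X : Type} [Finite X] {A : Type u}
    [BiheytingAlgebra A] (a : X → A) : (termValues a).FinitelyGenerated :=
  ⟨Set.range a, Set.finite_range a, range_subset_termValues a, fun T hT => by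
    rintro _ ⟨s, rfl⟩
    exact T.eval_mem hT s⟩

theorem IsPresentedBy.exists_term {V : Variety} {A : Type u} [BiheytingAlgebra A] {n : ℕ}
    {a : Fin n → A} {R : Set (Equation (Fin n))} (h : IsPresentedBy V A a R) (x : A) :
    ∃ s : Term (Fin n), s.eval a = x := by
  have hx : x ∈ (Subalgebra.termValues a).carrier := by
    rw [h.generates _ (Subalgebra.range_subset_termValues a)]
    trivial
  exact hx

/-! ### Existence of presented algebras -/

section Presented

variable (V : Variety) {n : ℕ} (R : Set (Equation (Fin n)))

/-- Terms, regarded as representing elements of the algebra with given relations. -/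
def PresentedTerm (_ : Variety) {n : ℕ} (_ : Set (Equation (Fin n))) : Type u :=
  ULift.{u} (Term (Fin n))

/-- The inequalities that follow from the relations in the variety. -/
instance PresentedTerm.instPreorder : Preorder (PresentedTerm.{u} V R) where
  le s t := ∀ (B : Type u) [BiheytingAlgebra B], V.Mem B → ∀ b : Fin n → B,
    (∀ ε ∈ R, ε.Holds b) → s.down.eval b ≤ t.down.eval b
  le_refl _ _ _ _ _ _ := le_rfl
  le_trans _ _ _ h₁ h₂ B _ hB b hb := (h₁ B hB b hb).trans (h₂ B hB b hb)

/-- The algebra presented by given relations. -/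
abbrev PresentedAlgebra : Type u := Antisymmetrization (PresentedTerm.{u} V R) (· ≤ ·)

namespace PresentedAlgebra

/-- The element represented by a term. -/
def mk (s : Term (Fin n)) : PresentedAlgebra.{u} V R :=
  toAntisymmetrization (· ≤ ·) (⟨s⟩ : PresentedTerm.{u} V R)

variable {V R}

theorem mk_surjective : Function.Surjective (mk.{u} V R) := fun x => by
  obtain ⟨⟨s⟩, rfl⟩ := Quotient.exists_rep x
  exact ⟨s, rfl⟩

theorem mk_le_mk {s t : Term (Fin n)} : mk.{u} V R s ≤ mk V R t ↔
    ∀ (B : Type u) [BiheytingAlgebra B], V.Mem B → ∀ b : Fin n → B,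
      (∀ ε ∈ R, ε.Holds b) → s.eval b ≤ t.eval b := Iff.rfl

theorem mk_eq_mk {s t : Term (Fin n)} : mk.{u} V R s = mk V R t ↔
    ∀ (B : Type u) [BiheytingAlgebra B], V.Mem B → ∀ b : Fin n → B,
      (∀ ε ∈ R, ε.Holds b) → s.eval b = t.eval b := by
  rw [le_antisymm_iff, mk_le_mk, mk_le_mk]
  exact ⟨fun h B _ hB b hb => le_antisymm (h.1 B hB b hb) (h.2 B hB b hb),
    fun h => ⟨fun B _ hB b hb => (h B hB b hb).le, fun B _ hB b hb => (h B hB b hb).ge⟩⟩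

/-- A representative of an element. -/
noncomputable def rep (x : PresentedAlgebra.{u} V R) : Term (Fin n) := (mk_surjective x).choose

@[simp]
theorem mk_rep (x : PresentedAlgebra.{u} V R) : mk V R (rep x) = x := (mk_surjective x).choose_spec

theorem le_iff {x y : PresentedAlgebra.{u} V R} : x ≤ y ↔
    ∀ (B : Type u) [BiheytingAlgebra B], V.Mem B → ∀ b : Fin n → B,
      (∀ ε ∈ R, ε.Holds b) → (rep x).eval b ≤ (rep y).eval b := by
  conv_lhs => rw [← mk_rep x, ← mk_rep y]
  exact mk_le_mk

/-- Operations on classes are defined through chosen representatives; no model of the relations sees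
the choice, so every law below can be checked model by model. -/
theorem eval_rep_mk (s : Term (Fin n)) (B : Type u) [BiheytingAlgebra B] (hB : V.Mem B)
    (b : Fin n → B) (hb : ∀ ε ∈ R, ε.Holds b) :
    (rep (mk.{u} V R s)).eval b = s.eval b :=
  mk_eq_mk.1 (mk_rep (mk.{u} V R s)) B hB b hb

noncomputable instance instBiheytingAlgebra : BiheytingAlgebra (PresentedAlgebra.{u} V R) where
  sup x y := mk V R (.sup (rep x) (rep y))
  inf x y := mk V R (.inf (rep x) (rep y))
  himp x y := mk V R (.imp (rep x) (rep y))
  sdiff x y := mk V R (.sub (rep x) (rep y))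
  bot := mk V R .bot
  top := mk V R .top
  compl x := mk V R (.imp (rep x) .bot)
  hnot x := mk V R (.sub .top (rep x))
  le_sup_left x y := le_iff.2 fun B _ hB b hb => by simp [eval_rep_mk _ B hB b hb, Term.eval]
  le_sup_right x y := le_iff.2 fun B _ hB b hb => by simp [eval_rep_mk _ B hB b hb, Term.eval]
  sup_le x y z h₁ h₂ := le_iff.2 fun B _ hB b hb => by
    simpa [eval_rep_mk _ B hB b hb, Term.eval] using
      ⟨le_iff.1 h₁ B hB b hb, le_iff.1 h₂ B hB b hb⟩
  inf_le_left x y := le_iff.2 fun B _ hB b hb => by simp [eval_rep_mk _ B hB b hb, Term.eval]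
  inf_le_right x y := le_iff.2 fun B _ hB b hb => by simp [eval_rep_mk _ B hB b hb, Term.eval]
  le_inf x y z h₁ h₂ := le_iff.2 fun B _ hB b hb => by
    simpa [eval_rep_mk _ B hB b hb, Term.eval] using
      ⟨le_iff.1 h₁ B hB b hb, le_iff.1 h₂ B hB b hb⟩
  le_top x := le_iff.2 fun B _ hB b hb => by simp [eval_rep_mk _ B hB b hb, Term.eval]
  bot_le x := le_iff.2 fun B _ hB b hb => by simp [eval_rep_mk _ B hB b hb, Term.eval]
  le_himp_iff x y z := by
    rw [le_iff, le_iff]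
    refine forall_congr' fun B => forall_congr' fun _ => forall_congr' fun hB =>
      forall_congr' fun b => forall_congr' fun hb => ?_
    have h₁ := eval_rep_mk (.imp (rep y) (rep z)) B hB b hb
    have h₂ := eval_rep_mk (.inf (rep x) (rep y)) B hB b hb
    exact (iff_of_eq (congrArg (_ ≤ ·) h₁)).trans
      (le_himp_iff.trans (iff_of_eq (congrArg (· ≤ _) h₂.symm)))
  sdiff_le_iff x y z := by
    rw [le_iff, le_iff]
    refine forall_congr' fun B => forall_congr' fun _ => forall_congr' fun hB =>
      forall_congr' fun b => forall_congr' fun hb => ?_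
    have h₁ := eval_rep_mk (.sub (rep x) (rep y)) B hB b hb
    have h₂ := eval_rep_mk (.sup (rep y) (rep z)) B hB b hb
    exact (iff_of_eq (congrArg (· ≤ _) h₁)).trans
      (sdiff_le_iff.trans (iff_of_eq (congrArg (_ ≤ ·) h₂.symm)))
  himp_bot x := mk_eq_mk.2 fun B _ hB b hb => by
    simp only [Term.eval]
    rw [eval_rep_mk _ B hB b hb]
    rfl
  top_sdiff x := mk_eq_mk.2 fun B _ hB b hb => by
    simp only [Term.eval]
    rw [eval_rep_mk _ B hB b hb]
    rfl

theorem eval_eq_mk_subst {X : Type} (a : X → PresentedAlgebra.{u} V R) (s : Term X) :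
    s.eval a = mk V R (s.subst fun x => rep (a x)) := by
  have key : ∀ {s t : Term (Fin n)}, (∀ (B : Type u) [BiheytingAlgebra B], V.Mem B →
      ∀ b : Fin n → B, (∀ ε ∈ R, ε.Holds b) → s.eval b = t.eval b) →
        mk.{u} V R s = mk V R t := mk_eq_mk.2
  induction s with
  | var x => exact (mk_rep _).symm
  | bot => rfl
  | top => rfl
  | inf s t hs ht | sup s t hs ht | imp s t hs ht | sub s t hs ht =>
    simp only [Term.eval, hs, ht]
    refine key fun B _ hB b hb => ?_
    simp only [Term.eval, Term.subst]
    rw [eval_rep_mk _ B hB b hb, eval_rep_mk _ B hB b hb]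

theorem eval_generators (s : Term (Fin n)) :
    s.eval (fun i => mk.{u} V R (.var i)) = mk V R s := by
  rw [eval_eq_mk_subst, mk_eq_mk]
  intro B _ hB b hb
  rw [Term.eval_subst]
  congr 1
  funext i
  exact eval_rep_mk _ B hB b hb

theorem isPresentedBy :
    IsPresentedBy V (PresentedAlgebra.{u} V R) (fun i => mk V R (.var i)) R where
  mem ε hε a := by
    -- Through representatives, an identity of the variety becomes a substitution instance of
    -- itself, valid in every model.
    unfold Equation.Holds
    rw [eval_eq_mk_subst, eval_eq_mk_subst, mk_eq_mk]
    intro B _ hB b hb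
    rw [Term.eval_subst, Term.eval_subst]
    exact hB ε hε _
  generates T hT := by
    refine Set.eq_univ_of_forall fun x => ?_
    obtain ⟨s, rfl⟩ := mk_surjective x
    rw [← eval_generators]
    exact T.eval_mem hT s
  relations ε hε := by
    unfold Equation.Holds
    rw [eval_generators, eval_generators, mk_eq_mk]
    exact fun B _ hB b hb => hb ε hε
  lift B _ hB b hb :=
    ⟨{  toFun := fun x => (rep x).eval b
        map_sup' := fun _ _ => eval_rep_mk _ B hB b hb
        map_inf' := fun _ _ => eval_rep_mk _ B hB b hb
        map_himp' := fun _ _ => eval_rep_mk _ B hB b hb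
        map_sdiff' := fun _ _ => eval_rep_mk _ B hB b hb },
      fun _ => eval_rep_mk _ B hB b hb⟩

end PresentedAlgebra

end Presented

/-! ### Products and reduced powers -/

theorem Term.eval_pi {ι : Type} {X : Type} {A : ι → Type u} [∀ i, BiheytingAlgebra (A i)]
    (a : X → ∀ i, A i) (s : Term X) (i : ι) : s.eval a i = s.eval fun x => a x i := by
  induction s <;> simp_all [Term.eval]

theorem Variety.Mem.pi {V : Variety} {ι : Type} {A : ι → Type u} [∀ i, BiheytingAlgebra (A i)]
    (h : ∀ i, V.Mem (A i)) : V.Mem (∀ i, A i) := fun ε hε a => by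
  unfold Equation.Holds
  funext i
  rw [Term.eval_pi, Term.eval_pi]
  exact h i ε hε _

/-- Both residuation laws are pointwise equivalences of inequalities, so they pass to germs along
any filter. -/
instance instBiheytingAlgebraGerm {ι : Type} (l : Filter ι) (A : Type u) [BiheytingAlgebra A] :
    BiheytingAlgebra (l.Germ A) where
  __ : Lattice (l.Germ A) := inferInstance
  __ : BoundedOrder (l.Germ A) := inferInstance
  himp := Germ.map₂ (· ⇨ ·)
  sdiff := Germ.map₂ (· \ ·)
  compl := Germ.map (·ᶜ)
  hnot := Germ.map (￢·)
  le_himp_iff x y z := Germ.inductionOn₃ x y z fun _ _ _ =>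
    eventually_congr <| .of_forall fun _ => le_himp_iff
  sdiff_le_iff x y z := Germ.inductionOn₃ x y z fun _ _ _ =>
    eventually_congr <| .of_forall fun _ => sdiff_le_iff
  himp_bot x := Germ.inductionOn x fun f =>
    congrArg (Germ.ofFun (l := l)) (funext fun i => himp_bot (f i))
  top_sdiff x := Germ.inductionOn x fun f =>
    congrArg (Germ.ofFun (l := l)) (funext fun i => top_sdiff' (f i))

theorem Term.eval_germ {ι X : Type} {l : Filter ι} {A : Type u} [BiheytingAlgebra A]
    (a : X → ι → A) (s : Term X) :
    s.eval (fun x => (a x : l.Germ A)) = ((fun i => s.eval fun x => a x i : ι → A) : l.Germ A) := by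
  induction s with
  | var x => rfl
  | bot => rfl
  | top => rfl
  | inf s t hs ht | sup s t hs ht | imp s t hs ht | sub s t hs ht =>
    simp only [Term.eval, hs, ht]
    rfl

theorem Equation.holds_germ {ι X : Type} {l : Filter ι} {A : Type u} [BiheytingAlgebra A]
    {a : X → ι → A} {ε : Equation X} :
    ε.Holds (fun x => (a x : l.Germ A)) ↔ ∀ᶠ i in l, ε.Holds fun x => a x i := by
  unfold Equation.Holds
  rw [Term.eval_germ, Term.eval_germ, Germ.coe_eq]
  rfl

theorem Variety.Mem.germ {V : Variety} {ι : Type} (l : Filter ι) {A : Type u} [BiheytingAlgebra A]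
    (h : V.Mem A) : V.Mem (l.Germ A) := fun ε hε a => by
  choose f hf using fun x => Quotient.exists_rep (a x)
  obtain rfl : (fun x => (f x : l.Germ A)) = a := funext hf
  exact Equation.holds_germ.2 (.of_forall fun i => h ε hε _)

/-! ### The canonical extension by lower sets of prime ideals -/

section PrimeIdeals

variable (A : Type u) [BiheytingAlgebra A]

/-- The prime ideals of the lattice `A`. -/
abbrev PrimeIdeals : Type u := {I : Order.Ideal A // I.IsPrime}

/-- The representation of `A` by lower sets of prime ideals. -/
def primeEmbedding : BoundedLatticeHom A (LowerSet (PrimeIdeals A)) where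
  toFun a := ⟨{I | a ∉ I.1}, fun _ _ h hI hJ => hI (h hJ)⟩
  map_sup' a b := by
    ext I
    change a ⊔ b ∉ I.1 ↔ a ∉ I.1 ∨ b ∉ I.1
    rw [Order.Ideal.sup_mem_iff]
    tauto
  map_inf' a b := by
    ext I
    change a ⊓ b ∉ I.1 ↔ a ∉ I.1 ∧ b ∉ I.1
    have h₁ : a ∈ I.1 → a ⊓ b ∈ I.1 := I.1.lower inf_le_left
    have h₂ : b ∈ I.1 → a ⊓ b ∈ I.1 := I.1.lower inf_le_right
    have h₃ : a ⊓ b ∈ I.1 → a ∈ I.1 ∨ b ∈ I.1 := I.2.mem_or_mem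
    tauto
  map_top' := by
    ext I
    exact ⟨fun _ => trivial, fun _ => I.2.toIsProper.top_notMem⟩
  map_bot' := by
    ext I
    exact ⟨fun h => h I.1.bot_mem, fun h => h.elim⟩

variable {A}

theorem mem_primeEmbedding {a : A} {I : PrimeIdeals A} : I ∈ primeEmbedding A a ↔ a ∉ I.1 :=
  Iff.rfl

theorem exists_primeIdeal {F : Order.PFilter A} {J : Order.Ideal A}
    (h : Disjoint (F : Set A) (J : Set A)) :
    ∃ I : PrimeIdeals A, (∀ a ∈ J, a ∈ I.1) ∧ ∀ a ∈ F, a ∉ I.1 := by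
  obtain ⟨I, hI, hJ, hF⟩ := DistribLattice.prime_ideal_of_disjoint_filter_ideal h
  exact ⟨⟨I, hI⟩, fun a ha => hJ ha, fun a ha haI => Set.disjoint_left.1 hF ha haI⟩

theorem primeEmbedding_le_iff {a b : A} : primeEmbedding A a ≤ primeEmbedding A b ↔ a ≤ b := by
  refine ⟨fun h => ?_, fun h => OrderHomClass.mono (primeEmbedding A) h⟩
  by_contra hab
  obtain ⟨I, hb, ha⟩ := exists_primeIdeal (F := Order.PFilter.principal a)
    (J := Order.Ideal.principal b) (Set.disjoint_left.2 fun c hc hc' => by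
      exact hab ((Order.PFilter.mem_principal.1 hc).trans (Order.Ideal.mem_principal.1 hc')))
  exact h (mem_primeEmbedding.2 (ha a (Order.PFilter.mem_principal.2 le_rfl)))
    (hb b (Order.Ideal.mem_principal.2 le_rfl))

/-- A lower set is the union of the principal lower sets ↓I of its members, and ↓I is the meet of
the images of all a ∉ I. Dually, it is the intersection of the complements of ↑I for I outside it,
and such a complement is the join of the images of all a ∈ I. Compactness is the prime ideal
theorem. -/
theorem isCanonicalExtension_primeEmbedding : IsCanonicalExtension (primeEmbedding A) where
  injective a b h := le_antisymm (primeEmbedding_le_iff.1 h.le) (primeEmbedding_le_iff.1 h.ge)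
  dense_closed x := by
    refine ⟨{k | ∃ I ∈ x, k = sInf (primeEmbedding A '' {a | a ∉ I.1})}, ?_, ?_⟩
    · rintro _ ⟨I, -, rfl⟩
      exact ⟨_, rfl⟩
    · ext J
      refine Iff.trans ?_ LowerSet.mem_sSup_iff.symm
      constructor
      · intro hJ
        refine ⟨_, ⟨J, hJ, rfl⟩, LowerSet.mem_sInf_iff.2 ?_⟩
        rintro _ ⟨a, ha, rfl⟩
        exact ha
      · rintro ⟨_, ⟨I, hI, rfl⟩, hJ⟩
        refine x.lower (fun a ha => ?_ : J ≤ I) hI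
        by_contra hIa
        exact LowerSet.mem_sInf_iff.1 hJ _ ⟨a, hIa, rfl⟩ ha
  dense_open x := by
    refine ⟨{o | ∃ I ∉ x, o = sSup (primeEmbedding A '' {a | a ∈ I.1})}, ?_, ?_⟩
    · rintro _ ⟨I, -, rfl⟩
      exact ⟨_, rfl⟩
    · ext J
      refine Iff.trans ?_ LowerSet.mem_sInf_iff.symm
      constructor
      · rintro hJ _ ⟨I, hI, rfl⟩
        by_contra hJ'
        refine hI (x.lower (fun a ha => ?_ : I ≤ J) hJ)
        by_contra hJa
        exact hJ' (LowerSet.mem_sSup_iff.2 ⟨_, ⟨a, ha, rfl⟩, hJa⟩)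
      · intro h
        by_contra hJ
        obtain ⟨_, ⟨a, ha, rfl⟩, ha'⟩ := LowerSet.mem_sSup_iff.1 (h _ ⟨J, hJ, rfl⟩)
        exact ha' ha
  compact S T hS hT := by
    constructor
    · intro h
      -- `F` and `J` collect what finite parts of `S` and `T` control. A common element gives the
      -- finite subsets; otherwise a prime ideal separating them lies in the meet of `S` but not in
      -- the join of `T`.
      let F : Order.PFilter A := Order.IsPFilter.toPFilter
        (F := {a | ∃ S₀ ⊆ S, S₀.Finite ∧ sInf S₀ ≤ primeEmbedding A a}) <| by
        refine .of_def ⟨⊤, ∅, by simp⟩ ?_ ?_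
        · rintro a ⟨S₁, h₁, f₁, l₁⟩ b ⟨S₂, h₂, f₂, l₂⟩
          refine ⟨a ⊓ b, ⟨S₁ ∪ S₂, Set.union_subset h₁ h₂, f₁.union f₂, ?_⟩, inf_le_left,
            inf_le_right⟩
          rw [InfHomClass.map_inf, sInf_union]
          exact inf_le_inf l₁ l₂
        · rintro a b hab ⟨S₁, h₁, f₁, l₁⟩
          exact ⟨S₁, h₁, f₁, l₁.trans (primeEmbedding_le_iff.2 hab)⟩
      let J : Order.Ideal A := Order.IsIdeal.toIdeal
        (I := {a | ∃ T₀ ⊆ T, T₀.Finite ∧ primeEmbedding A a ≤ sSup T₀}) <| by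
        refine ⟨?_, ⟨⊥, ∅, by simp⟩, ?_⟩
        · rintro a b hab ⟨T₁, h₁, f₁, l₁⟩
          exact ⟨T₁, h₁, f₁, (primeEmbedding_le_iff.2 hab).trans l₁⟩
        · rintro a ⟨T₁, h₁, f₁, l₁⟩ b ⟨T₂, h₂, f₂, l₂⟩
          refine ⟨a ⊔ b, ⟨T₁ ∪ T₂, Set.union_subset h₁ h₂, f₁.union f₂, ?_⟩, le_sup_left,
            le_sup_right⟩
          rw [SupHomClass.map_sup, sSup_union]
          exact sup_le_sup l₁ l₂
      by_cases hFJ : Disjoint (F : Set A) (J : Set A)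
      · obtain ⟨I, hJ, hF⟩ := exists_primeIdeal hFJ
        have hI : I ∈ sInf S := by
          refine LowerSet.mem_sInf_iff.2 fun k hk => ?_
          obtain ⟨X, rfl⟩ := hS k hk
          refine LowerSet.mem_sInf_iff.2 ?_
          rintro _ ⟨a, ha, rfl⟩
          refine hF a ⟨{sInf (primeEmbedding A '' X)}, by simpa using hk, Set.finite_singleton _, ?_⟩
          rw [sInf_singleton]
          exact sInf_le ⟨a, ha, rfl⟩
        obtain ⟨o, ho, hIo⟩ := LowerSet.mem_sSup_iff.1 (h hI)
        obtain ⟨X, rfl⟩ := hT o ho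
        obtain ⟨_, ⟨a, ha, rfl⟩, hIa⟩ := LowerSet.mem_sSup_iff.1 hIo
        refine absurd (hJ a ?_) hIa
        refine ⟨{sSup (primeEmbedding A '' X)}, by simpa using ho, Set.finite_singleton _, ?_⟩
        rw [sSup_singleton]
        exact le_sSup ⟨a, ha, rfl⟩
      · obtain ⟨a, ⟨S₀, hS₀, fS, lS⟩, ⟨T₀, hT₀, fT, lT⟩⟩ := Set.not_disjoint_iff.1 hFJ
        exact ⟨S₀, hS₀, T₀, hT₀, fS, fT, lS.trans lT⟩
    · rintro ⟨S₀, hS₀, T₀, hT₀, -, -, h⟩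
      exact (sInf_le_sInf hS₀).trans (h.trans (sSup_le_sSup hT₀))

end PrimeIdeals

/-! ### Embedding an algebra into its canonical extension -/

section CanonicalHom

variable {A C : Type u} [BiheytingAlgebra A] [CompleteLattice C] (e : BoundedLatticeHom A C)

theorem isBox_self (a b : A) : IsBox e (e a) (e b) (e a) (e a) (e b) (e b) where
  closed₁ := ⟨{a}, by simp⟩
  open₁ := ⟨{a}, by simp⟩
  closed₂ := ⟨{b}, by simp⟩
  open₂ := ⟨{b}, by simp⟩
  le₁ := le_rfl
  ge₁ := le_rfl
  le₂ := le_rfl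
  ge₂ := le_rfl

variable {e}

theorem IsBox.mem_boxValues {a b : A} {k₁ o₁ k₂ o₂ : C} (h : IsBox e (e a) (e b) k₁ o₁ k₂ o₂)
    (f : A → A → A) : e (f a b) ∈ boxValues e f k₁ o₁ k₂ o₂ :=
  ⟨a, b, h.le₁, h.ge₁, h.le₂, h.ge₂, rfl⟩

theorem boxValues_self (he : Function.Injective e) (f : A → A → A) (a b : A) :
    boxValues e f (e a) (e a) (e b) (e b) = {e (f a b)} := by
  refine Set.eq_singleton_iff_unique_mem.2 ⟨(isBox_self e a b).mem_boxValues f, ?_⟩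
  rintro _ ⟨a', b', h₁, h₂, h₃, h₄, rfl⟩
  rw [he (le_antisymm h₁ h₂), he (le_antisymm h₃ h₄)]

/-- Elements of `A` are both closed and open, so there is a box reduced to the point itself, and
every other box around the point contains it. -/
theorem piExt_map (he : Function.Injective e) (f : A → A → A) (a b : A) :
    piExt e f (e a) (e b) = e (f a b) := by
  refine le_antisymm (sInf_le ⟨_, _, _, _, isBox_self e a b, ?_⟩) (le_sInf ?_)
  · rw [boxValues_self he, sSup_singleton]
  · rintro _ ⟨k₁, o₁, k₂, o₂, h, rfl⟩
    exact le_sSup (h.mem_boxValues f)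

theorem sigmaExt_map (he : Function.Injective e) (f : A → A → A) (a b : A) :
    sigmaExt e f (e a) (e b) = e (f a b) := by
  refine le_antisymm (sSup_le ?_) (le_sSup ⟨_, _, _, _, isBox_self e a b, ?_⟩)
  · rintro _ ⟨k₁, o₁, k₂, o₂, h, rfl⟩
    exact sInf_le (h.mem_boxValues f)
  · rw [boxValues_self he, sInf_singleton]

/-- The algebra on the canonical extension carries its own order, only equivalent to that of `C`.
The isomorphism `φ` keeps the two structures on separate types, and completeness is transported as
existence of all meets. -/
theorem exists_complete_extension_of_orderIso (he : Function.Injective e) {D : Type u}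
    [BiheytingAlgebra D] (φ : C ≃o D)
    (himp : ∀ x y, φ (piExt e (fun a b => a ⇨ b) x y) = φ x ⇨ φ y)
    (hsub : ∀ x y, φ (sigmaExt e (fun a b => a \ b) x y) = φ x \ φ y) :
    ∃ f : BiheytingHom A D, Function.Injective f ∧ ∀ s : Set D, ∃ m, IsGLB s m := by
  refine ⟨⟨⟨⟨fun a => φ (e a), fun a b => ?_⟩, fun a b => ?_⟩, fun a b => ?_, fun a b => ?_⟩,
    φ.injective.comp he, fun s => ⟨φ (sInf (φ ⁻¹' s)), ?_⟩⟩
  · rw [SupHomClass.map_sup, SupHomClass.map_sup]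
  · change φ (e (a ⊓ b)) = φ (e a) ⊓ φ (e b)
    rw [InfHomClass.map_inf, InfHomClass.map_inf]
  · change φ (e (a ⇨ b)) = φ (e a) ⇨ φ (e b)
    rw [← himp, piExt_map he]
  · change φ (e (a \ b)) = φ (e a) \ φ (e b)
    rw [← hsub, sigmaExt_map he]
  · exact φ.isGLB_preimage.1 (isGLB_sInf _)

end CanonicalHom

/-- This is all that the argument needs from canonical extensions: each member embeds into a
complete member. -/
theorem Variety.ClosedUnderCanonicalExtensions.exists_complete_extension {V : Variety}
    (hV : ClosedUnderCanonicalExtensions.{u} V) {A : Type u} [BiheytingAlgebra A] (hA : V.Mem A) :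
    ∃ (C : Type u) (_ : BiheytingAlgebra C) (f : BiheytingHom A C), V.Mem C ∧
      Function.Injective f ∧ ∀ s : Set C, ∃ m, IsGLB s m := by
  have he := isCanonicalExtension_primeEmbedding (A := A)
  obtain ⟨inst, hinst, hmem⟩ := hV A hA _ _ he
  let φ := @RelIso.mk _ _ (· ≤ ·) inst.le (Equiv.refl (LowerSet (PrimeIdeals A)))
    fun {x y} => hinst.le_iff x y
  obtain ⟨f, hf, hinf⟩ := @exists_complete_extension_of_orderIso A _ _ _ _ he.injective _ inst φ
    (fun x y => (hinst.himp_eq x y).symm) (fun x y => (hinst.sdiff_eq x y).symm)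
  exact ⟨_, inst, f, hmem, hf, hinf⟩

/-! ### The term `¬∼x` -/

section Interior

variable {A : Type u} [BiheytingAlgebra A]

/-- The operation `x ↦ ¬∼x`. -/
def interior (x : A) : A := (￢x)ᶜ

/-- Being right adjoint to x ↦ ∼¬x, the operation ¬∼ preserves all existing meets. -/
theorem le_interior_iff {x y : A} : x ≤ interior y ↔ ￢(xᶜ) ≤ y :=
  le_compl_comm.trans hnot_le_comm

theorem interior_le (x : A) : interior x ≤ x := by
  calc (￢x)ᶜ = (￢x)ᶜ ⊓ (x ⊔ ￢x) := by rw [sup_hnot_self, inf_top_eq]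
    _ = (￢x)ᶜ ⊓ x := by rw [inf_sup_left, compl_inf_self, sup_bot_eq]
    _ ≤ x := inf_le_right

theorem interior_mono : Monotone (interior : A → A) := fun _ _ h =>
  compl_anti (hnot_anti h)

theorem interior_iterate_top (n : ℕ) : interior^[n] (⊤ : A) = ⊤ :=
  Function.iterate_fixed (by simp [interior]) n

theorem interior_iterate_anti (x : A) : Antitone fun n => interior^[n] x :=
  antitone_nat_of_succ_le fun n => by
    rw [Function.iterate_succ_apply']
    exact interior_le _

/-- By the adjunction, `m ≤ interior m` reduces to `m` lying below the successor of each iterate. -/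
theorem interior_eq_self_of_isGLB {x m : A} (h : IsGLB (Set.range fun n => interior^[n] x) m) :
    interior m = m := by
  refine le_antisymm (interior_le m) (le_interior_iff.2 (h.2 ?_))
  rintro _ ⟨n, rfl⟩
  refine le_interior_iff.1 ?_
  rw [← Function.iterate_succ_apply' interior]
  exact h.1 ⟨n + 1, rfl⟩

theorem isCompl_hnot_of_interior_eq {x : A} (h : interior x = x) : IsCompl x (￢x) := by
  refine ⟨?_, codisjoint_hnot_right⟩
  conv_lhs => rw [← h]
  exact disjoint_compl_left

/-- The term operation `x ↦ ¬∼x`. -/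
def Term.interior {X : Type} (s : Term X) : Term X := .imp (.sub .top s) .bot

theorem Term.eval_interior {X : Type} (s : Term X) (a : X → A) :
    s.interior.eval a = DoubleHeyting.interior (s.eval a) := by
  simp [Term.interior, Term.eval, DoubleHeyting.interior]

theorem Term.eval_interior_iterate {X : Type} (s : Term X) (a : X → A) (n : ℕ) :
    (Term.interior^[n] s).eval a = DoubleHeyting.interior^[n] (s.eval a) := by
  induction n with
  | zero => rfl
  | succ n ih => rw [Function.iterate_succ_apply', Function.iterate_succ_apply', eval_interior, ih]

theorem map_interior_iterate {B : Type u} [BiheytingAlgebra B] (f : BiheytingHom A B) (x : A)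
    (n : ℕ) : f (interior^[n] x) = interior^[n] (f x) :=
  Function.Semiconj.iterate_right (fun x => by simp [interior]) n x

end Interior

/-! ### Coherence bounds the iterates of `¬∼x` -/

/-- The relations `z ≤ y ≤ x` and `¬∼y = y` between generators `x, z, y`, in this order. -/
def fixedPointRelations : Set (Equation (Fin 3)) :=
  {(.inf (.var 1) (.var 2), .var 1), (.inf (.var 2) (.var 0), .var 2),
    ((Term.var 2).interior, .var 2)}

theorem holds_fixedPointRelations {A : Type u} [BiheytingAlgebra A] {a : Fin 3 → A} :
    (∀ ε ∈ fixedPointRelations, ε.Holds a) ↔ a 1 ≤ a 2 ∧ a 2 ≤ a 0 ∧ interior (a 2) = a 2 := by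
  simp [fixedPointRelations, Equation.Holds, Term.eval_interior, Term.eval]

/-- Equations between `x` and `z` that follow from `z ≤ y ≤ x` and `¬∼y = y` hold for all but
finitely many pairs `a, (¬∼)ⁿa`. -/
theorem eventually_holds_of_holds {V : Variety}
    (hV : Variety.ClosedUnderCanonicalExtensions.{u} V) {D : Type u} [BiheytingAlgebra D] {d : Fin 3 → D}
    (hD : IsPresentedBy V D d fixedPointRelations) {A : Type u} [BiheytingAlgebra A]
    (hA : V.Mem A) (a : A) {ε : Equation (Fin 2)} (hε : ε.Holds ![d 0, d 1]) :
    ∀ᶠ n in atTop, ε.Holds ![a, interior^[n] a] := by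
  obtain ⟨C, _, f, hC, hf, hinf⟩ := hV.exists_complete_extension (hA.germ (atTop : Filter ℕ))
  let x : (atTop : Filter ℕ).Germ A := ((fun _ => a : ℕ → A) : Germ _ A)
  let z : (atTop : Filter ℕ).Germ A := ((fun n => interior^[n] a : ℕ → A) : Germ _ A)
  have hz : ∀ k, z ≤ interior^[k] x := by
    intro k
    have hx : interior^[k] x = ((fun _ => interior^[k] a : ℕ → A) : Germ atTop A) := by
      induction k with
      | zero => rfl
      | succ k ih => rw [Function.iterate_succ_apply', ih, Function.iterate_succ_apply']; rfl
    rw [hx]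
    exact (eventually_ge_atTop k).mono fun n hn => interior_iterate_anti a hn
  -- The meet of all iterates interprets y; it need not exist in the reduced power itself.
  obtain ⟨m, hm⟩ := hinf (Set.range fun n => interior^[n] (f x))
  obtain ⟨g, hg⟩ := hD.lift C hC ![f x, f z, m] <| holds_fixedPointRelations.2
    ⟨hm.2 (by
        rintro _ ⟨n, rfl⟩
        change f z ≤ interior^[n] (f x)
        rw [← map_interior_iterate]
        exact OrderHomClass.mono f (hz n)),
      hm.1 ⟨0, rfl⟩, interior_eq_self_of_isGLB hm⟩
  have h₁ : ε.Holds ![x, z] := by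
    refine .of_map f hf ?_
    convert hε.map g using 1
    funext i
    fin_cases i
    · exact (hg 0).symm
    · exact (hg 1).symm
  have h₂ : ![x, z] = fun i =>
      ((![fun _ => a, fun n => interior^[n] a] i : ℕ → A) : Germ atTop A) := by
    funext i
    fin_cases i <;> rfl
  rw [h₂, Equation.holds_germ] at h₁
  refine h₁.mono fun n hn => ?_
  convert hn using 1
  funext i
  fin_cases i <;> rfl

/-- Finite presentability of the subalgebra generated by x and z turns "for each equation, almost
all n" into one n that works for all equations at once. -/
theorem Variety.exists_interior_iterate_le_of_mem {V : Variety}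
    (hV : ClosedUnderCanonicalExtensions.{u} V) (hV' : Coherent.{u} V) {A : Type u}
    [BiheytingAlgebra A] (hA : V.Mem A) (a : A) :
    ∃ n, interior^[n] a ≤ interior^[n + 1] a := by
  have hD := PresentedAlgebra.isPresentedBy.{u} (V := V) (R := fixedPointRelations)
  set D := PresentedAlgebra.{u} V fixedPointRelations
  set d : Fin 3 → D := fun i => PresentedAlgebra.mk V fixedPointRelations (.var i)
  obtain ⟨hzy, hyx, hy⟩ := holds_fixedPointRelations.1 hD.relations
  let S := Subalgebra.termValues ![d 0, d 1]
  obtain ⟨m, s, R, hR, hS⟩ := hV' D ⟨3, d, _, by simp [fixedPointRelations], hD⟩ S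
    (Subalgebra.finitelyGenerated_termValues _)
  -- The presenting generators `s` need not be x and z. The terms `p` write them in x and z; `u` and
  -- `v` below write x and z in them, and these two expressions join the list of equations to be
  -- realised.
  choose p hp using fun i => (s i).2
  have hp' : ∀ r : Term (Fin m), (r.subst p).eval ![d 0, d 1] = S.inclusion (r.eval s) := fun r => by
    rw [Term.eval_subst, Term.map_eval]
    congr 1
    exact funext hp
  let x : S.Elem := ⟨d 0, .var 0, rfl⟩
  let z : S.Elem := ⟨d 1, .var 1, rfl⟩
  obtain ⟨u, hu⟩ := hS.exists_term x
  obtain ⟨v, hv⟩ := hS.exists_term z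
  have hev := fun ε => eventually_holds_of_holds hV hD hA a (ε := ε)
  have hrel := (eventually_all_finite hR).2 fun ε hε => hev (ε.subst p) <| by
    have := (hS.relations ε hε).map S.inclusion
    rw [Equation.holds_subst]
    convert this using 1
    exact funext hp
  have hux := hev (u.subst p, .var 0) <| by
    change (u.subst p).eval _ = _
    rw [hp', hu]
    rfl
  have hvz := hev (v.subst p, .var 1) <| by
    change (v.subst p).eval _ = _
    rw [hp', hv]
    rfl
  obtain ⟨n, hn, hux, hvz⟩ := (hrel.and (hux.and hvz)).exists
  obtain ⟨f, hf⟩ := hS.lift A hA (fun i => (p i).eval ![a, interior^[n] a]) fun ε hε =>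
    Equation.holds_subst.1 (hn ε hε)
  have hfx : f x = a := by
    rw [← hu, Term.map_eval]
    simp only [hf]
    rw [← Term.eval_subst]
    exact hux
  have hfz : f z = interior^[n] a := by
    rw [← hv, Term.map_eval]
    simp only [hf]
    rw [← Term.eval_subst]
    exact hvz
  -- The fixed point y is available only in `D`, but the inequality that it forces involves x and z
  -- alone, so it descends to `S`.
  have hzx : z ≤ interior^[n + 1] x := by
    change S.inclusion z ≤ S.inclusion (interior^[n + 1] x)
    rw [map_interior_iterate]
    calc S.inclusion z ≤ d 2 := hzy
      _ = interior^[n + 1] (d 2) := (Function.iterate_fixed hy _).symm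
      _ ≤ _ := interior_mono.iterate _ hyx
  refine ⟨n, ?_⟩
  calc interior^[n] a = f z := hfz.symm
    _ ≤ f (interior^[n + 1] x) := OrderHomClass.mono f hzx
    _ = _ := by rw [map_interior_iterate, hfx]

/-- If each n failed for some element of some member, the product of these algebras would contain an
element whose bound n contradicts the choice at coordinate n. -/
theorem Variety.exists_interior_iterate_eq {V : Variety}
    (hV : ClosedUnderCanonicalExtensions.{u} V) (hV' : Coherent.{u} V) :
    ∃ n, ∀ (A : Type u) [BiheytingAlgebra A], V.Mem A → ∀ a : A,
      interior (interior^[n] a) = interior^[n] a := by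
  by_contra! h
  choose A inst hA a ha using h
  obtain ⟨n, hn⟩ := exists_interior_iterate_le_of_mem hV hV' (Mem.pi hA) a
  have hpi : ∀ k, interior^[k] a n = interior^[k] (a n) := fun k => by
    induction k with
    | zero => rfl
    | succ k ih =>
      rw [Function.iterate_succ_apply', Function.iterate_succ_apply', ← ih]
      rfl
  have := hn n
  rw [hpi, hpi, Function.iterate_succ_apply'] at this
  exact ha n (le_antisymm (interior_le _) this)

/-! ### Complemented elements and the discriminator -/

section Complemented

variable {A : Type u} [BiheytingAlgebra A]

/-- For complements e and f, equal meets with e and equal joins with f are the same condition. The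
first form suits implication, the second subtraction. -/
theorem sup_eq_sup_of_inf_eq_inf {e f x y : A} (h : IsCompl e f) (hxy : x ⊓ e = y ⊓ e) :
    x ⊔ f = y ⊔ f := by
  have key : ∀ w : A, w ⊔ f = w ⊓ e ⊔ f := fun w => by
    rw [sup_inf_right, h.sup_eq_top, inf_top_eq]
  rw [key x, key y, hxy]

theorem inf_eq_inf_of_sup_eq_sup {e f x y : A} (h : IsCompl e f) (hxy : x ⊔ f = y ⊔ f) :
    x ⊓ e = y ⊓ e := by
  have key : ∀ w : A, w ⊓ e = (w ⊔ f) ⊓ e := fun w => by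
    rw [inf_sup_right, h.symm.inf_eq_bot, sup_bot_eq]
  rw [key x, key y, hxy]

theorem himp_inf_le_of_inf_eq_inf {e x x' y y' : A} (hx : x ⊓ e = x' ⊓ e) (hy : y ⊓ e = y' ⊓ e) :
    (x ⇨ y) ⊓ e ≤ (x' ⇨ y') ⊓ e := by
  refine le_inf (le_himp_iff.2 ?_) inf_le_right
  calc (x ⇨ y) ⊓ e ⊓ x' = (x ⇨ y) ⊓ x ⊓ e := by rw [inf_assoc, inf_comm e, ← hx, inf_assoc]
    _ ≤ y ⊓ e := inf_le_inf_right _ himp_inf_le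
    _ ≤ y' := hy ▸ inf_le_left

theorem sdiff_sup_le_of_sup_eq_sup {f x x' y y' : A} (hx : x ⊔ f = x' ⊔ f) (hy : y ⊔ f = y' ⊔ f) :
    x \ y ⊔ f ≤ x' \ y' ⊔ f := by
  refine sup_le (sdiff_le_iff.2 ?_) le_sup_right
  calc x ≤ x' ⊔ f := hx ▸ le_sup_left
    _ ≤ (y' ⊔ x' \ y') ⊔ f := sup_le_sup_right le_sup_sdiff _
    _ = y ⊔ (x' \ y' ⊔ f) := by
      rw [sup_right_comm, ← hy, sup_right_comm, sup_assoc]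

/-- The congruence of a complemented element, the kernel of the projection `x ↦ x ⊓ e`. -/
def congruenceOfIsCompl {e f : A} (h : IsCompl e f) : Congruence A where
  r x y := x ⊓ e = y ⊓ e
  iseqv := ⟨fun _ => rfl, Eq.symm, Eq.trans⟩
  inf {x x' y y'} hx hy := by
    rw [inf_inf_distrib_right, inf_inf_distrib_right x', show x ⊓ e = x' ⊓ e from hx,
      show y ⊓ e = y' ⊓ e from hy]
  sup {x x' y y'} hx hy := by
    rw [inf_sup_right, inf_sup_right, show x ⊓ e = x' ⊓ e from hx,
      show y ⊓ e = y' ⊓ e from hy]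
  himp hx hy := le_antisymm (himp_inf_le_of_inf_eq_inf hx hy)
    (himp_inf_le_of_inf_eq_inf hx.symm hy.symm)
  sdiff hx hy := by
    have hx' := sup_eq_sup_of_inf_eq_inf h hx
    have hy' := sup_eq_sup_of_inf_eq_inf h hy
    exact inf_eq_inf_of_sup_eq_sup h (le_antisymm (sdiff_sup_le_of_sup_eq_sup hx' hy')
      (sdiff_sup_le_of_sup_eq_sup hx'.symm hy'.symm))

theorem congruenceOfIsCompl_eq_bot {e f : A} (h : IsCompl e f)
    (hbot : (congruenceOfIsCompl h).toSetoid = ⊥) : e = ⊤ := by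
  have : (congruenceOfIsCompl h).toSetoid e ⊤ := by
    change e ⊓ e = ⊤ ⊓ e
    simp
  rwa [hbot] at this

/-- The congruences of e and f intersect in equality, so they cannot both lie above the least
nontrivial congruence. -/
theorem SubdirectlyIrreducible.eq_bot_or_eq_top (hA : SubdirectlyIrreducible A) {e f : A}
    (h : IsCompl e f) : e = ⊥ ∨ e = ⊤ := by
  obtain ⟨μ, hμ, hmin⟩ := hA
  by_contra! hne
  refine hμ (le_bot_iff.1 fun x y hxy => ?_)
  have h₁ : x ⊓ e = y ⊓ e := hmin (congruenceOfIsCompl h)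
    (fun hbot => hne.2 (congruenceOfIsCompl_eq_bot h hbot)) hxy
  have h₂ : x ⊓ f = y ⊓ f := hmin (congruenceOfIsCompl h.symm)
    (fun hbot => hne.1 (disjoint_top.1 (congruenceOfIsCompl_eq_bot h.symm hbot ▸ h.disjoint))) hxy
  have key : ∀ w : A, w = w ⊓ e ⊔ w ⊓ f := fun w => by
    rw [← inf_sup_left, h.sup_eq_top, inf_top_eq]
  change x = y
  rw [key x, key y, h₁, h₂]

end Complemented

/-- The term `(e ∧ c) ∨ (¬e ∧ a)`, with `e = (¬∼)ⁿ((a → b) ∧ (b → a))`. -/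
def discriminatorTerm (n : ℕ) : Term (Fin 3) :=
  let e := Term.interior^[n] (.inf (.imp (.var 0) (.var 1)) (.imp (.var 1) (.var 0)))
  .sup (.inf e (.var 2)) (.inf (.imp e .bot) (.var 0))

theorem isDiscriminatorTerm_discriminatorTerm {A : Type u} [BiheytingAlgebra A]
    (hA : SubdirectlyIrreducible A) {n : ℕ}
    (hn : ∀ a : A, interior (interior^[n] a) = interior^[n] a) :
    IsDiscriminatorTerm (discriminatorTerm n) A := by
  intro a b c
  simp only [discriminatorTerm, Term.eval, Term.eval_interior_iterate, Matrix.cons_val]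
  constructor
  · rintro rfl
    simp [interior_iterate_top]
  · intro hab
    have he : interior^[n] ((a ⇨ b) ⊓ (b ⇨ a)) = ⊥ := by
      -- The iterate is a fixed point, hence complemented. Were it 1, the larger element (a → b) ∧
      -- (b → a) would be 1 as well, forcing a = b.
      refine (hA.eq_bot_or_eq_top (isCompl_hnot_of_interior_eq (hn _))).resolve_right fun h => hab ?_
      have h' : (a ⇨ b) ⊓ (b ⇨ a) = ⊤ :=
        top_le_iff.1 (h ▸ interior_iterate_anti _ (Nat.zero_le n))
      rw [inf_eq_top_iff, himp_eq_top_iff, himp_eq_top_iff] at h'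
      exact le_antisymm h'.1 h'.2
    simp [he]

end DoubleHeyting

theorem theorem5p6 (V : DoubleHeyting.Variety)
    (hcanonical : DoubleHeyting.Variety.ClosedUnderCanonicalExtensions.{u} V)
    (hcoherent : DoubleHeyting.Variety.Coherent.{u} V) :
    DoubleHeyting.Variety.IsDiscriminatorVariety.{u} V := by
  obtain ⟨n, hn⟩ := DoubleHeyting.Variety.exists_interior_iterate_eq hcanonical hcoherent
  exact ⟨DoubleHeyting.discriminatorTerm n, fun A _ hA hSI =>
    DoubleHeyting.isDiscriminatorTerm_discriminatorTerm hSI (hn A hA)⟩
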